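/- All graphs are finite and simple. For a graph $F$ and a graph $G$ on $n\ge |V(F)|$ vertices, let $p(F,G)$ be the number of $|V(F)|$-subsets of $V(G)$ that induce a subgraph of $G$ isomorphic to $F$, divided by $\binom{n}{|V(F)|}$. For an integer $k\ge 3$ let $i_k(F,n)$ be the maximum of $p(F,G)$ over all $K_k$-free graphs $G$ on $n$ vertices, and let $i_k(F)=\lim_{n\to\infty} i_k(F,n)$. A graphon is a measurable symmetric function $W:[0,1]^2\to\{0,1\}$; distinct points $u,v\in[0,1]$ are adjacent if $W(u,v)=1$. The induced density of $F$ in $W$ is the probability that $|V(F)|$ independent uniformly random points of $[0,1]$ induce a copy of $F$. We say that $i_k(F)$ is attained by $W$ if $W$ is $K_k$-free (no $k$ distinct points are pairwise adjacent), and the limit $i_k(F)$ exists and equals the induced density of $F$ in $W$. For $x_1,\dots,x_\ell\ge 0$ with $x_1+\dots+x_\ell=1$, let $W[x_1,\dots,x_\ell]$ be the graphon obtained by partitioning $[0,1]$ into $\ell$ consecutive intervals of lengths $x_1,\dots,x_\ell$ and setting $W(u,v)=1$ if and only if $u$ and $v$ lie in distinct intervals. Let $K_r^-$ be the complete graph on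 $r$ vertices with one edge removed. **Theorem.** Let $r\ge 3$ and $k\ge 3$ be integers and let $t=\left\lceil \frac{(r-2)(3r+1)}{6}\right\rceil$. If $k\le t+1$, then $i_k(K_r^-)$ is attained by $W\big[\tfrac1{k-1},\dots,\tfrac1{k-1}\big]$ (with $k-1$ parts). If $k>t+1$, then $i_k(K_r^-)$ is attained by $W\big[\tfrac1t,\dots,\tfrac1t\big]$ (with $t$ parts). -/

import Mathlib

open scoped unitInterval Topology

noncomputable section

namespace Inducibility

open MeasureTheory Filter

/-- The induced density `p(F, G)`: the number of vertex subsets of `G` that induce a subgraph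
isomorphic to `F`, divided by the number of all vertex subsets of size `|V(F)|`. -/
def inducedDensity {V U : Type*} [Fintype V] [Fintype U]
    (F : SimpleGraph V) (G : SimpleGraph U) : ℝ :=
  (Set.ncard {S : Finset U | Nonempty (G.induce (S : Set U) ≃g F)} : ℝ) /
    ((Fintype.card U).choose (Fintype.card V) : ℝ)

/-- `i_H(F, n)`: the maximum of `p(F, G)` over all `H`-free graphs `G` on `n` vertices
(no subgraph of `G`, induced or not, is isomorphic to `H`). -/
def maxInducedDensity {A V : Type*} [Fintype V]
    (H : SimpleGraph A) (F : SimpleGraph V) (n : ℕ) : ℝ :=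
  ⨆ G : {G : SimpleGraph (Fin n) // H.Free G}, inducedDensity F G.1

/-- A graphon: a (measurable) symmetric function `[0,1]² → {0,1}`. -/
structure Graphon where
  toFun : I → I → Fin 2
  symm' : ∀ x y, toFun x y = toFun y x
  measurable' : Measurable (Function.uncurry toFun)

/-- The graph on the points of `[0,1]` given by a graphon: distinct points `x`, `y` are adjacent
iff `W(x, y) = 1`. -/
def Graphon.toGraph (W : Graphon) : SimpleGraph I where
  Adj x y := x ≠ y ∧ W.toFun x y = 1
  symm := ⟨fun x y h => ⟨h.1.symm, by rw [W.symm' y x]; exact h.2⟩⟩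
  loopless := ⟨fun _ h => h.1 rfl⟩

/-- The induced density of `F` in a graphon: the probability that `|V(F)|` independent uniformly
random points of `[0,1]` are distinct and induce a copy of `F`. -/
def Graphon.density {V : Type*} [Fintype V] (W : Graphon) (F : SimpleGraph V) : ℝ :=
  (volume : Measure (V → I)).real
    {p | Function.Injective p ∧ Nonempty (W.toGraph.comap p ≃g F)}

/-- For a point `x` of the standard simplex, cut `[0,1]` at `c₁ ≤ c₂ ≤ ⋯ ≤ c_ℓ = 1`, where
`c_j` is the sum of the first `j` coordinates. The intervals are `[0, c₁]`, `(c₁, c₂]`, …,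
`(c_{ℓ-1}, 1]`, of lengths `x₁, …, x_ℓ`; this is the index (counted from `0`) of the interval
containing `u`, i.e. the number of cut points that lie strictly to the left of `u`. -/
def intervalIndex {l : ℕ} (x : Fin l → ℝ) (u : I) : ℕ :=
  (Finset.univ.filter fun j : Fin l => ∑ i ∈ Finset.Iic j, x i < (u : ℝ)).card

theorem measurable_intervalIndex {l : ℕ} (x : Fin l → ℝ) : Measurable (intervalIndex x) := by
  unfold intervalIndex
  simp only [Finset.card_filter]
  refine Finset.measurable_sum _ fun j _ => ?_
  refine Measurable.ite ?_ measurable_const measurable_const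
  exact measurableSet_lt measurable_const measurable_subtype_coe

/-- The complete partite graphon `W[x₁, …, x_ℓ]`: `W(u, v) = 1` iff `u` and `v` lie in distinct
intervals of the partition of `[0,1]` into intervals of lengths `x₁, …, x_ℓ`. -/
def completePartiteGraphon {l : ℕ} (x : Fin l → ℝ) : Graphon where
  toFun u v := if intervalIndex x u = intervalIndex x v then 0 else 1
  symm' u v := by simp only [eq_comm]
  measurable' := by
    refine Measurable.ite ?_ measurable_const measurable_const
    exact measurableSet_eq_fun ((measurable_intervalIndex x).comp measurable_fst)
      ((measurable_intervalIndex x).comp measurable_snd)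

/-- `i_H(F)`, the limit of `i_H(F, n)` as `n → ∞`, is attained by the graphon `W`: the graphon is
`H`-free, and the limit exists and equals the induced density of `F` in `W`. -/
def IsAttainedBy {A V : Type*} [Fintype V]
    (H : SimpleGraph A) (F : SimpleGraph V) (W : Graphon) : Prop :=
  H.Free W.toGraph ∧ Tendsto (maxInducedDensity H F) atTop (𝓝 (W.density F))

/-- `K_r^-`: the complete graph on `r` vertices with one edge removed. -/
def almostComplete (r : ℕ) (hr : 2 ≤ r) : SimpleGraph (Fin r) :=
  (⊤ : SimpleGraph (Fin r)).deleteEdges {s(⟨0, by omega⟩, ⟨1, by omega⟩)}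

end Inducibility

end

/-! Let `G` be `K_k`-free on `n` vertices, with `c_s` cliques of size `s` and `N` induced copies of
`K_r^-`. Count pairs `(S, a)` where `S` is an `r`-set, `a ∈ S` and `S \ {a}` is a clique: each
`K_r^-` gives two, each `K_r` gives `r`, and a pair is determined by an `(r-1)`-clique and a vertex.
So `2N + r c_r ≤ n c_{r-1}` (`two_mul_ncard_add_le`). In a complete multipartite graph a vertex
outside a clique misses at most one of its vertices, so there the loss is of lower order.

Divided by `n ^ r`, the quantity `n c_{r-1} - r c_r` is the value at uniform weights of a clique
polynomial with coefficients `1` and `-r`. A Motzkin–Straus argument, valid for coefficients of any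
sign (`cliquePoly_le`), bounds it by the largest value at uniform weights on an `l`-clique, `l < k`.
That value is `(r-1) * balancedValue r l`.

It remains to see that `balancedValue r` increases up to `t` and decreases afterwards. With `m = l +
1`, the step from `l` to `m` is governed by the sign of `(1 - 1/m) ^ r - (1 - (r-1)/m)`, which the
Bonferroni inequalities of orders three and four decide.

Conversely, the residue colouring mod `l` gives finite graphs whose densities tend to that of the
balanced graphon. `isAttainedBy_uniform` squeezes the two bounds together. -/

open scoped unitInterval Topology

namespace Inducibility

open MeasureTheory Filter

/-! ### Clique polynomials on the simplex: a Motzkin–Straus argument -/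

/-- The clique polynomial of `G` with coefficients depending on the size of the clique. -/
noncomputable def cliquePoly {V : Type*} [Fintype V] (G : SimpleGraph V) (w : ℕ → ℝ) (x : V → ℝ) :
    ℝ :=
  open Classical in ∑ T : Finset V, if G.IsClique (T : Set V) then w T.card * ∏ i ∈ T, x i else 0

theorem continuous_cliquePoly {V : Type*} [Fintype V] (G : SimpleGraph V) (w : ℕ → ℝ) :
    Continuous (cliquePoly G w) := by
  unfold cliquePoly
  refine continuous_finsetSum _ fun T _ => ?_
  split_ifs <;> fun_prop

theorem prod_update_update {V : Type*} [DecidableEq V] (x : V → ℝ) {u v : V}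
    (huv : u ≠ v) (T : Finset V) (p q : ℝ) :
    ∏ i ∈ T, Function.update (Function.update x u p) v q i =
      (if u ∈ T then p else 1) * (if v ∈ T then q else 1) * ∏ i ∈ (T.erase u).erase v, x i := by
  have h1 : ∀ (T : Finset V) (y : V → ℝ) (v : V) (q : ℝ),
      ∏ i ∈ T, Function.update y v q i = (if v ∈ T then q else 1) * ∏ i ∈ T.erase v, y i := by
    intro T y v q
    by_cases h : v ∈ T
    · rw [← Finset.mul_prod_erase _ _ h, if_pos h, Function.update_self]
      congr 1
      exact Finset.prod_congr rfl fun i hi =>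
        Function.update_of_ne (Finset.ne_of_mem_erase hi) _ _
    · rw [if_neg h, one_mul, Finset.erase_eq_of_notMem h]
      refine Finset.prod_congr rfl fun i hi => Function.update_of_ne ?_ _ _
      rintro rfl; exact h hi
  rw [h1, h1, Finset.erase_right_comm]
  simp only [Finset.mem_erase, huv, ne_eq, not_false_eq_true, true_and]
  ring

/-- The clique polynomial is affine in each variable. -/
theorem exists_cliquePoly_update_eq {V : Type*} [Fintype V] [DecidableEq V] (G : SimpleGraph V)
    (w : ℕ → ℝ) (x : V → ℝ) {u v : V} (huv : u ≠ v) :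
    ∃ A B C D : ℝ, (¬ G.Adj u v → D = 0) ∧ ∀ p q,
      cliquePoly G w (Function.update (Function.update x u p) v q) =
        A + B * p + C * q + D * (p * q) := by
  classical
  -- The four coefficients sort the cliques by which of `u`, `v` they contain; no clique contains
  -- both when `u`, `v` are not adjacent.
  let c : Finset V → ℝ := fun T =>
    if G.IsClique (T : Set V) then w T.card * ∏ i ∈ (T.erase u).erase v, x i else 0
  refine ⟨∑ T, if u ∈ T then 0 else if v ∈ T then 0 else c T,
    ∑ T, if u ∈ T then if v ∈ T then 0 else c T else 0,
    ∑ T, if u ∈ T then 0 else if v ∈ T then c T else 0,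
    ∑ T, if u ∈ T then if v ∈ T then c T else 0 else 0, ?_, ?_⟩
  · intro h
    refine Finset.sum_eq_zero fun T _ => ?_
    split_ifs with hu hv
    · refine if_neg fun hT => h (hT hu hv huv)
    · rfl
    · rfl
  · intro p q
    simp only [cliquePoly, Finset.sum_mul, ← Finset.sum_add_distrib]
    refine Finset.sum_congr rfl fun T _ => ?_
    rw [prod_update_update x huv]
    simp only [c]
    split_ifs <;> ring

/-- For weights vanishing off a clique, every non-clique term has a zero factor. The clique
condition can then be dropped, and what remains is a symmetric polynomial. -/
theorem cliquePoly_comp_swap {V : Type*} [Fintype V] [DecidableEq V] (G : SimpleGraph V)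
    (w : ℕ → ℝ) (x : V → ℝ) (K : Finset V) (hK : G.IsClique (K : Set V))
    (hx : ∀ i, i ∉ K → x i = 0) {u v : V} (hu : u ∈ K) (hv : v ∈ K) :
    cliquePoly G w (x ∘ Equiv.swap u v) = cliquePoly G w x := by
  classical
  have key : ∀ y : V → ℝ, (∀ i, i ∉ K → y i = 0) →
      cliquePoly G w y = ∑ T : Finset V, w T.card * ∏ i ∈ T, y i := by
    intro y hy
    refine Finset.sum_congr rfl fun T _ => ?_
    split_ifs with h
    · rfl
    · have : ∃ i ∈ T, i ∉ K := by
        by_contra! hc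
        exact h (hK.subset (by exact_mod_cast hc))
      obtain ⟨i, hi, hiK⟩ := this
      rw [Finset.prod_eq_zero hi (hy i hiK), mul_zero]
  rw [key x hx, key]
  · refine Fintype.sum_equiv (Equiv.finsetCongr (Equiv.swap u v)) _ _ fun T => ?_
    simp [Equiv.finsetCongr_apply]
  · intro i hi
    have h1 : i ≠ u := fun h => hi (h ▸ hu)
    have h2 : i ≠ v := fun h => hi (h ▸ hv)
    simp [Equiv.swap_apply_of_ne_of_ne h1 h2, hx i hi]

/-- A maximiser of the clique polynomial with minimal support is supported uniformly on a
clique. -/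
theorem cliquePoly_le {V : Type*} [Fintype V] (G : SimpleGraph V) (w : ℕ → ℝ)
    {k : ℕ} (hG : G.CliqueFree k) (M : ℝ)
    (hM : ∀ l, 1 ≤ l → l < k →
      ∑ s ∈ Finset.range (l + 1), (l.choose s : ℝ) * (w s * (1 / (l : ℝ)) ^ s) ≤ M)
    (x₀ : V → ℝ) (hx₀ : x₀ ∈ stdSimplex ℝ V) : cliquePoly G w x₀ ≤ M := by
  classical
  obtain ⟨x₁, hx₁, hmax₁⟩ := (isCompact_stdSimplex ℝ V).exists_isMaxOn ⟨x₀, hx₀⟩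
    (continuous_cliquePoly G w).continuousOn
  let S : Set (V → ℝ) := {x | x ∈ stdSimplex ℝ V ∧ IsMaxOn (cliquePoly G w) (stdSimplex ℝ V) x}
  let supp : (V → ℝ) → Finset V := fun x => Finset.univ.filter fun i => x i ≠ 0
  let x := Function.argminOn (fun x => (supp x).card) S ⟨x₁, hx₁, hmax₁⟩
  have hxS : x ∈ S := Function.argminOn_mem _ _ _
  have hmin : ∀ y ∈ S, (supp x).card ≤ (supp y).card := fun y hy =>
    Function.argminOn_le (fun x => (supp x).card) S hy
  clear_value x
  obtain ⟨hx, hmax⟩ := hxS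
  have hmax' : ∀ y ∈ stdSimplex ℝ V, cliquePoly G w y ≤ cliquePoly G w x := fun y hy => hmax hy
  refine (hmax' x₀ hx₀).trans ?_
  -- shifting mass between two points of the support
  have shift : ∀ u v, u ≠ v → x u ≠ 0 → x v ≠ 0 → ∃ D : ℝ, 0 < D ∧ G.Adj u v ∧
      ∀ p q, 0 ≤ p → 0 ≤ q → p + q = x u + x v →
        cliquePoly G w (Function.update (Function.update x u p) v q) =
          cliquePoly G w x - D * (p - x u) ^ 2 := by
    intro u v huv hu hv
    obtain ⟨A, B, C, D, hD, hP⟩ := exists_cliquePoly_update_eq G w x huv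
    have hu0 : 0 < x u := lt_of_le_of_ne (hx.1 u) (Ne.symm hu)
    have hv0 : 0 < x v := lt_of_le_of_ne (hx.1 v) (Ne.symm hv)
    have hxx : cliquePoly G w x = A + B * x u + C * x v + D * (x u * x v) := by
      rw [← hP]; simp
    have hmem : ∀ p q, 0 ≤ p → 0 ≤ q → p + q = x u + x v →
        Function.update (Function.update x u p) v q ∈ stdSimplex ℝ V := by
      intro p q hp hq hpq
      refine ⟨fun i => ?_, ?_⟩
      · by_cases hi : i = v
        · subst hi; simpa using hq
        · by_cases hi' : i = u
          · subst hi'; simpa [hi] using hp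
          · simpa [hi, hi'] using hx.1 i
      · rw [← hx.2, Finset.sum_update_of_mem (Finset.mem_univ _),
          ← Finset.add_sum_erase _ x (Finset.mem_univ v),
          ← Finset.add_sum_erase (Finset.univ.erase v) x (a := u) (by simp [huv]),
          Finset.sdiff_singleton_eq_erase,
          ← Finset.add_sum_erase (Finset.univ.erase v) (Function.update x u p) (a := u)
            (by simp [huv]),
          Finset.sum_congr rfl fun i hi =>
            Function.update_of_ne (Finset.ne_of_mem_erase hi) p x]
        simp only [Function.update_self]
        linarith
    have hval : ∀ l, -x u ≤ l → l ≤ x v → l * (B - C + D * (x v - x u)) - l ^ 2 * D ≤ 0 := by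
      intro l h1 h2
      have := hmax' _ (hmem (x u + l) (x v - l) (by linarith) (by linarith) (by ring))
      rw [hP, hxx] at this
      nlinarith
    -- First-order condition: both `u` and `v` carry mass, so shifts by `ε` and by `-ε` stay in the
    -- simplex.
    have hE : B - C + D * (x v - x u) = 0 := by
      set E := B - C + D * (x v - x u) with hE'
      have hlim : ∀ ε : ℝ, 0 < ε → ε ≤ min (x u) (x v) → |E| ≤ ε * |D| := by
        intro ε h0 h1
        have hu1 := h1.trans (min_le_left _ _)
        have hv1 := h1.trans (min_le_right _ _)
        have a := hval ε (by linarith) hv1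
        have b := hval (-ε) (by linarith) (by linarith)
        have a' : E ≤ ε * D := by
          by_contra! hc
          nlinarith
        have b' : -E ≤ ε * D := by
          by_contra! hc
          nlinarith
        calc |E| ≤ ε * D := abs_le.2 ⟨by linarith, a'⟩
          _ ≤ ε * |D| := mul_le_mul_of_nonneg_left (le_abs_self D) h0.le
      by_contra hne
      have hEpos : 0 < |E| := abs_pos.2 hne
      have hm : 0 < min (x u) (x v) := lt_min hu0 hv0
      have hDn := abs_nonneg D
      have h1 := hlim (min (min (x u) (x v)) (|E| / (2 * (|D| + 1)))) (by positivity)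
        (min_le_left _ _)
      have h2 : min (min (x u) (x v)) (|E| / (2 * (|D| + 1))) * |D| ≤
          |E| / (2 * (|D| + 1)) * |D| := mul_le_mul_of_nonneg_right (min_le_right _ _) hDn
      have h3 : |E| / (2 * (|D| + 1)) * |D| < |E| := by
        rw [div_mul_eq_mul_div, div_lt_iff₀ (by positivity)]
        nlinarith
      linarith
    have hform : ∀ p q, p + q = x u + x v →
        cliquePoly G w (Function.update (Function.update x u p) v q) =
          cliquePoly G w x - D * (p - x u) ^ 2 := by
      intro p q hpq
      obtain rfl : q = x u + x v - p := by linarith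
      rw [hP, hxx]
      linear_combination (p - x u) * hE
    -- If `D ≤ 0`, moving all the mass of `u` to `v` does not lower the value and empties `u`,
    -- against minimality of the support.
    have hDpos : 0 < D := by
      by_contra! hD0
      have hle : cliquePoly G w x ≤
          cliquePoly G w (Function.update (Function.update x u 0) v (x u + x v)) := by
        rw [hform _ _ (by ring)]
        nlinarith [sq_nonneg (0 - x u)]
      have := hmin (Function.update (Function.update x u 0) v (x u + x v))
        ⟨hmem _ _ le_rfl (by linarith) (by ring), fun y hy => (hmax' y hy).trans hle⟩
      refine absurd this (not_le.2 (Finset.card_lt_card ?_))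
      refine Finset.ssubset_iff_of_subset ?_ |>.2 ⟨u, by simp [supp, hu], by simp [supp, huv]⟩
      intro i hi
      simp only [supp, Finset.mem_filter, Finset.mem_univ, true_and] at hi ⊢
      by_cases hi1 : i = v
      · subst hi1; exact hv
      · by_cases hi2 : i = u
        · subst hi2; exact hu
        · simpa [hi1, hi2] using hi
    refine ⟨D, hDpos, ?_, fun p q _ _ => hform p q⟩
    by_contra hadj
    exact hDpos.ne' (hD hadj)
  set K := supp x with hKdef
  have hmemK : ∀ i, i ∈ K ↔ x i ≠ 0 := fun i => by simp [hKdef, supp]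
  have hclique : G.IsClique (K : Set V) := by
    intro u hu v hv huv
    obtain ⟨D, -, h, -⟩ := shift u v huv ((hmemK u).1 hu) ((hmemK v).1 hv)
    exact h
  have hout : ∀ i, i ∉ K → x i = 0 := fun i hi => by
    by_contra h; exact hi ((hmemK i).2 h)
  have hconst : ∀ u ∈ K, ∀ v ∈ K, x u = x v := by
    intro u hu v hv
    by_cases huv : u = v
    · rw [huv]
    obtain ⟨D, hD, -, h⟩ := shift u v huv ((hmemK u).1 hu) ((hmemK v).1 hv)
    -- Exchanging the two masses costs `D * (x v - x u) ^ 2` by the shift formula, and nothing by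
    -- symmetry on the clique.
    have h1 := h (x v) (x u) (hx.1 v) (hx.1 u) (add_comm _ _)
    have h2 : Function.update (Function.update x u (x v)) v (x u) = x ∘ Equiv.swap u v := by
      funext i
      by_cases hi1 : i = v
      · subst hi1; simp
      · by_cases hi2 : i = u
        · subst hi2; simp [hi1]
        · simp [hi1, hi2, Equiv.swap_apply_of_ne_of_ne]
    rw [h2, cliquePoly_comp_swap G w x K hclique hout hu hv] at h1
    have h3 : D * (x v - x u) ^ 2 = 0 := by linarith
    have h4 : x v - x u = 0 := by simpa [hD.ne'] using h3
    linarith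
  have hsumK : ∑ i ∈ K, x i = 1 := by
    rw [← hx.2]
    exact Finset.sum_subset (Finset.subset_univ _) fun i _ hi => hout i hi
  have hKne : K.Nonempty := by
    by_contra h
    rw [Finset.not_nonempty_iff_eq_empty] at h
    rw [h] at hsumK; simp at hsumK
  have hKval : ∀ i ∈ K, x i = 1 / (K.card : ℝ) := by
    intro i hi
    have h1 : (K.card : ℝ) * x i = 1 := by
      rw [← hsumK, Finset.sum_congr rfl fun j hj => hconst j hj i hi]
      simp
    have h2 : (K.card : ℝ) ≠ 0 := by
      intro h; rw [h] at h1; simp at h1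
    field_simp
    linarith
  have hlt : K.card < k := by
    by_contra! hc
    obtain ⟨T, hT, hTc⟩ := Finset.exists_subset_card_eq hc
    exact hG T ⟨hclique.subset (by exact_mod_cast hT), hTc⟩
  refine le_trans (le_of_eq ?_) (hM K.card hKne.card_pos hlt)
  have hP : cliquePoly G w x = ∑ T ∈ K.powerset, w T.card * (1 / (K.card : ℝ)) ^ T.card := by
    rw [cliquePoly, ← Finset.sum_subset (Finset.subset_univ K.powerset)]
    · refine Finset.sum_congr rfl fun T hT => ?_
      rw [Finset.mem_powerset] at hT
      rw [if_pos (hclique.subset (by exact_mod_cast hT)),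
        Finset.prod_congr rfl fun i hi => hKval i (hT hi), Finset.prod_const]
    · intro T _ hT
      rw [Finset.mem_powerset, Finset.not_subset] at hT
      obtain ⟨i, hi, hiK⟩ := hT
      rw [Finset.prod_eq_zero hi (hout i hiK)]
      simp
  rw [hP, Finset.sum_powerset_apply_card fun s => w s * (1 / (K.card : ℝ)) ^ s]
  simp

/-! ### Unimodality of the balanced values -/

/-- Multiplying the truncated expansion for `n` by `1 - y` gives the one for `n + 1` plus the
nonnegative error `C(n,3) y ^ 4`. The fourth-order bound is the same with error `-C(n,4) y ^ 5`. -/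
theorem bonferroni_three (y : ℝ) (h0 : 0 ≤ y) (h1 : y ≤ 1) (r : ℕ) :
    1 - r * y + r * (r - 1) / 2 * y ^ 2 - r * (r - 1) * (r - 2) / 6 * y ^ 3 ≤ (1 - y) ^ r := by
  induction r with
  | zero => simp
  | succ n ih =>
    have hc : (0 : ℝ) ≤ n * (n - 1) * (n - 2) / 6 := by
      rcases n with _ | _ | _ | n
      · simp
      · simp
      · norm_num
      · push_cast
        have : (0 : ℝ) ≤ n := n.cast_nonneg
        have e1 : (n : ℝ) + 1 + 1 + 1 - 1 = n + 2 := by ring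
        have e2 : (n : ℝ) + 1 + 1 + 1 - 2 = n + 1 := by ring
        rw [e1, e2]; positivity
    have h2 := mul_le_mul_of_nonneg_left ih (sub_nonneg.2 h1)
    have h3 := mul_nonneg hc (pow_nonneg h0 4)
    rw [pow_succ' (1 - y)]
    push_cast
    refine le_trans ?_ h2
    linear_combination h3

theorem le_bonferroni_four (y : ℝ) (h0 : 0 ≤ y) (h1 : y ≤ 1) (r : ℕ) :
    (1 - y) ^ r ≤ 1 - r * y + r * (r - 1) / 2 * y ^ 2 - r * (r - 1) * (r - 2) / 6 * y ^ 3 +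
      r * (r - 1) * (r - 2) * (r - 3) / 24 * y ^ 4 := by
  induction r with
  | zero => simp
  | succ n ih =>
    have hc : (0 : ℝ) ≤ n * (n - 1) * (n - 2) * (n - 3) / 24 := by
      rcases n with _ | _ | _ | _ | n
      · simp
      · simp
      · norm_num
      · norm_num
      · push_cast
        have : (0 : ℝ) ≤ n := n.cast_nonneg
        have e1 : (n : ℝ) + 1 + 1 + 1 + 1 - 1 = n + 3 := by ring
        have e2 : (n : ℝ) + 1 + 1 + 1 + 1 - 2 = n + 2 := by ring
        have e3 : (n : ℝ) + 1 + 1 + 1 + 1 - 3 = n + 1 := by ring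
        rw [e1, e2, e3]; positivity
    have h2 := mul_le_mul_of_nonneg_left ih (sub_nonneg.2 h1)
    have h3 := mul_nonneg hc (pow_nonneg h0 5)
    rw [pow_succ' (1 - y)]
    push_cast
    refine le_trans h2 ?_
    linear_combination h3

/-- Up to a factor depending on `r` only, the density of `K_r^-` in the balanced complete
`l`-partite graphon. -/
noncomputable def balancedValue (r l : ℕ) : ℝ := (l.choose (r - 1) : ℝ) / (l : ℝ) ^ r

theorem choose_succ_mul {r l : ℕ} (hr : 3 ≤ r) (hl : r ≤ l + 1) :
    ((l + 1).choose (r - 1) : ℝ) * ((l : ℝ) + 1 + 1 - r) = l.choose (r - 1) * ((l : ℝ) + 1) := by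
  have h := Nat.choose_mul_succ_eq l (r - 1)
  have h' : l + 1 - (r - 1) + r = l + 1 + 1 := by omega
  have h'' : ((l + 1 - (r - 1) : ℕ) : ℝ) = (l : ℝ) + 1 + 1 - r := by
    rw [eq_sub_iff_add_eq]; exact_mod_cast h'
  rw [← h'']
  exact_mod_cast h.symm

/-- Reduces the comparison of consecutive values to that of `1 - (r-1)/m` with `(1 - 1/m) ^ r`,
where `m = l + 1`. -/
theorem balancedValue_succ_sub {r l : ℕ} (hr : 3 ≤ r) (hl : r ≤ l + 1) :
    balancedValue r (l + 1) * (1 - (r - 1) / ((l : ℝ) + 1)) =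
      balancedValue r l * (1 - 1 / ((l : ℝ) + 1)) ^ r := by
  have hl0 : (0 : ℝ) < l := by exact_mod_cast (by omega : 0 < l)
  have h := choose_succ_mul hr hl
  have e1 : (1 - 1 / ((l : ℝ) + 1)) = l / (l + 1) := by field_simp; ring
  have e2 : 1 - (r - 1) / ((l : ℝ) + 1) = ((l : ℝ) + 1 + 1 - r) / (l + 1) := by
    field_simp; ring
  unfold balancedValue
  rw [e1, e2, div_pow]
  push_cast
  field_simp
  linear_combination h

theorem balancedValue_nonneg (r l : ℕ) : 0 ≤ balancedValue r l := by
  unfold balancedValue; positivity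

theorem balancedValue_le_succ {r l t : ℕ} (hr : 3 ≤ r)
    (ht : (t : ℝ) < (r - 2) * (3 * r + 1) / 6 + 1) (hl : l < t) :
    balancedValue r l ≤ balancedValue r (l + 1) := by
  by_cases hlr : l < r - 1
  · rw [balancedValue, Nat.choose_eq_zero_of_lt hlr]
    simpa using balancedValue_nonneg r (l + 1)
  have hlr' : r ≤ l + 1 := by omega
  have hr3 : (3 : ℝ) ≤ r := by exact_mod_cast hr
  have hm1 : (r : ℝ) ≤ l + 1 := by exact_mod_cast hlr'
  -- Integrality gain: `(r-2)(3r+1)` is even, so the bound in `ht` is a multiple of `1/3` and the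
  -- strict inequality improves by `1/3`. This is needed: at `(r-2)(3r+1)/6 + 1` the quadratic in
  -- `hquad` equals `(r-2)²/9 > 0`.
  have hm2 : ((l : ℝ) + 1) ≤ (r - 2) * (3 * r + 1) / 6 + 2 / 3 := by
    obtain ⟨j, hj⟩ : ∃ j : ℕ, r = j + 2 := ⟨r - 2, by omega⟩
    have hlt : ((l : ℝ) + 1) ≤ t := by exact_mod_cast hl
    have hpar : Even (j * (3 * j + 7)) := by
      rcases Nat.even_or_odd j with h | h
      · exact h.mul_right _
      · exact Even.mul_left (by obtain ⟨a, rfl⟩ := h; exact ⟨3 * a + 5, by ring⟩) _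
    obtain ⟨a, ha⟩ := hpar
    have ha' : (j : ℝ) * (3 * j + 7) = a + a := by exact_mod_cast ha
    have hrj : (r : ℝ) = j + 2 := by exact_mod_cast hj
    have hA : ((r : ℝ) - 2) * (3 * r + 1) = a + a := by rw [← ha', hrj]; ring
    rw [hA] at ht ⊢
    have h3 : (3 * (l + 1) : ℝ) < a + 3 := by linarith
    have h4 : 3 * (l + 1) < a + 3 := by exact_mod_cast h3
    have h5 : 3 * (l + 1) ≤ a + 2 := by omega
    have h6 : (3 * (l + 1) : ℝ) ≤ a + 2 := by exact_mod_cast h5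
    linarith
  set m : ℝ := (l : ℝ) + 1 with hm
  have hmpos : 0 < m := by linarith
  have hy0 : 0 ≤ 1 / m := by positivity
  have hy1 : 1 / m ≤ 1 := by rw [div_le_one hmpos]; linarith
  have hquad : m ^ 2 - r * (r - 1) / 2 * m + r * (r - 1) * (r - 2) / 6 ≤ 0 := by
    -- For `r = 3` the bounds read `3 ≤ m ≤ 7/3`, so this case does not occur.
    have hr4 : (4 : ℝ) ≤ r := by
      by_contra! hc
      have : r < 4 := by exact_mod_cast hc
      have h3 : r = 3 := by omega
      rw [h3] at hm1 hm2
      norm_num at hm1 hm2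
      linarith
    nlinarith [mul_nonneg (sub_nonneg.2 hm1) (sub_nonneg.2 hm2),
      mul_nonneg (sub_nonneg.2 hr4) (sub_nonneg.2 hm1),
      mul_nonneg (mul_nonneg (sub_nonneg.2 hr4) (sub_nonneg.2 hr4)) (sub_nonneg.2 hm1),
      mul_nonneg (sub_nonneg.2 hr4) (sub_nonneg.2 hr4), mul_nonneg (sub_nonneg.2 hr4) (sub_nonneg.2 hm2)]
  have hkey : 1 - (r - 1) / m ≤ (1 - 1 / m) ^ r := by
    refine le_trans ?_ (bonferroni_three (1 / m) hy0 hy1 r)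
    have : 1 - r * (1 / m) + r * (r - 1) / 2 * (1 / m) ^ 2 - r * (r - 1) * (r - 2) / 6 * (1 / m) ^ 3
        - (1 - (r - 1) / m) =
        -(m ^ 2 - r * (r - 1) / 2 * m + r * (r - 1) * (r - 2) / 6) / m ^ 3 := by
      field_simp; ring
    have h2 : 0 ≤ -(m ^ 2 - r * (r - 1) / 2 * m + r * (r - 1) * (r - 2) / 6) / m ^ 3 :=
      div_nonneg (by linarith) (by positivity)
    linarith
  have hid := balancedValue_succ_sub hr hlr'
  rw [← hm] at hid
  have hpos : 0 < 1 - (r - 1) / m := by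
    rw [sub_pos, div_lt_one hmpos]; linarith
  have := mul_le_mul_of_nonneg_left hkey (balancedValue_nonneg r l)
  rw [← hid] at this
  exact le_of_mul_le_mul_right this hpos

theorem balancedValue_succ_le {r l : ℕ} (hr : 3 ≤ r)
    (hl : (r - 2 : ℝ) * (3 * r + 1) / 6 ≤ l) :
    balancedValue r (l + 1) ≤ balancedValue r l := by
  have hr3 : (3 : ℝ) ≤ r := by exact_mod_cast hr
  have hlr : r ≤ l + 1 := by
    have h : (r : ℝ) < l + 2 := by nlinarith
    have : r < l + 2 := by exact_mod_cast h
    omega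
  set m : ℝ := (l : ℝ) + 1 with hm
  have hmr : (r : ℝ) ≤ m := by rw [hm]; exact_mod_cast hlr
  have hmpos : 0 < m := by linarith
  have hy0 : 0 ≤ 1 / m := by positivity
  have hy1 : 1 / m ≤ 1 := by rw [div_le_one hmpos]; linarith
  have hcub : 0 ≤ m ^ 3 - r * (r - 1) / 2 * m ^ 2 + r * (r - 1) * (r - 2) / 6 * m -
      r * (r - 1) * (r - 2) * (r - 3) / 24 := by
    -- `s` is the excess of `m` over `(r-2)(3r+1)/6 + 1`; in terms of it the cubic is a sum of
    -- nonnegative terms.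
    obtain ⟨s, hs⟩ : ∃ s : ℝ, s = m - (r * (r - 1) / 2 - (r - 2) / 3) := ⟨_, rfl⟩
    have hs0 : 0 ≤ s := by rw [hs, hm]; linarith
    have e : m ^ 3 - r * (r - 1) / 2 * m ^ 2 + r * (r - 1) * (r - 2) / 6 * m -
        r * (r - 1) * (r - 2) * (r - 3) / 24 =
        s * (m * (m - (r - 2) / 3)) + ((r - 2) / 3) ^ 2 * s +
        (r - 2) / 216 * (3 * r ^ 3 - 8 * r ^ 2 + 29 * r - 32) := by
      rw [hs]; ring
    rw [e]
    have h1 : (0 : ℝ) ≤ m - (r - 2) / 3 := by linarith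
    have h2 : (0 : ℝ) ≤ 3 * r ^ 3 - 8 * r ^ 2 + 29 * r - 32 := by
      nlinarith [mul_nonneg (sub_nonneg.2 hr3) (sq_nonneg (r : ℝ))]
    have h3 : (0 : ℝ) ≤ (r - 2) / 216 := by linarith
    positivity
  have hkey : (1 - 1 / m) ^ r ≤ 1 - (r - 1) / m := by
    refine (le_bonferroni_four (1 / m) hy0 hy1 r).trans ?_
    have : 1 - (r - 1) / m - (1 - r * (1 / m) + r * (r - 1) / 2 * (1 / m) ^ 2 -
        r * (r - 1) * (r - 2) / 6 * (1 / m) ^ 3 +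
        r * (r - 1) * (r - 2) * (r - 3) / 24 * (1 / m) ^ 4) =
        (m ^ 3 - r * (r - 1) / 2 * m ^ 2 + r * (r - 1) * (r - 2) / 6 * m -
          r * (r - 1) * (r - 2) * (r - 3) / 24) / m ^ 4 := by
      field_simp; ring
    have h2 : 0 ≤ (m ^ 3 - r * (r - 1) / 2 * m ^ 2 + r * (r - 1) * (r - 2) / 6 * m -
          r * (r - 1) * (r - 2) * (r - 3) / 24) / m ^ 4 :=
      div_nonneg hcub (by positivity)
    linarith
  have hid := balancedValue_succ_sub hr hlr
  rw [← hm] at hid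
  have hpos : 0 < 1 - (r - 1) / m := by
    rw [sub_pos, div_lt_one hmpos]; linarith
  have := mul_le_mul_of_nonneg_left hkey (balancedValue_nonneg r l)
  rw [← hid] at this
  exact le_of_mul_le_mul_right this hpos

theorem balancedValue_mono {r t : ℕ} (hr : 3 ≤ r)
    (ht : (t : ℝ) < (r - 2) * (3 * r + 1) / 6 + 1) {a b : ℕ} (hab : a ≤ b) (hb : b ≤ t) :
    balancedValue r a ≤ balancedValue r b := by
  induction b, hab using Nat.le_induction with
  | base => exact le_rfl
  | succ b _ ih => exact (ih (by omega)).trans (balancedValue_le_succ hr ht (by omega))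

theorem balancedValue_anti {r t : ℕ} (hr : 3 ≤ r)
    (ht : (r - 2 : ℝ) * (3 * r + 1) / 6 ≤ t) {b : ℕ} (hb : t ≤ b) :
    balancedValue r b ≤ balancedValue r t := by
  induction b, hb using Nat.le_induction with
  | base => exact le_rfl
  | succ b hb ih =>
    refine (balancedValue_succ_le hr (ht.trans ?_)).trans ih
    exact_mod_cast hb

/-! ### Upper bound on the number of copies in a finite graph -/

theorem exists_perm_apply_eq {V : Type*} [DecidableEq V] {a b u v : V} (hab : a ≠ b)
    (huv : u ≠ v) : ∃ τ : Equiv.Perm V, τ u = a ∧ τ v = b := by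
  refine ⟨(Equiv.swap u a).trans (Equiv.swap (Equiv.swap u a v) b), ?_, ?_⟩
  · have h : a ≠ Equiv.swap u a v := fun h => huv (by
      have := congrArg (Equiv.swap u a) h
      simpa using this)
    simp [Equiv.swap_apply_of_ne_of_ne h hab]
  · simp

theorem almostComplete_adj {r : ℕ} (hr : 2 ≤ r) (x y : Fin r) :
    (almostComplete r hr).Adj x y ↔ x ≠ y ∧ s(x, y) ≠ s(⟨0, by omega⟩, ⟨1, by omega⟩) := by
  simp only [almostComplete, SimpleGraph.deleteEdges_adj, SimpleGraph.top_adj,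
    Set.mem_singleton_iff, ne_eq]

/-- A description without the marked vertices `0`, `1`, since permutations act transitively on
ordered pairs of distinct vertices. It serves both induced subgraphs and colour patterns. -/
theorem nonempty_iso_almostComplete_iff {V : Type*} [Fintype V] {r : ℕ} (hr : 2 ≤ r)
    (hV : Fintype.card V = r) (H : SimpleGraph V) :
    Nonempty (H ≃g almostComplete r hr) ↔
      ∃ u v, u ≠ v ∧ ∀ x y, H.Adj x y ↔ x ≠ y ∧ s(x, y) ≠ s(u, v) := by
  classical
  constructor
  · rintro ⟨φ⟩
    refine ⟨φ.symm ⟨0, by omega⟩, φ.symm ⟨1, by omega⟩, ?_, fun x y => ?_⟩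
    · intro h
      simpa using φ.symm.injective h
    · rw [← φ.map_adj_iff, almostComplete_adj, φ.injective.ne_iff]
      refine and_congr_right fun _ => not_congr ?_
      have h := (Sym2.map.injective φ.symm.injective).eq_iff (a := s(φ x, φ y))
        (b := s((⟨0, by omega⟩ : Fin r), ⟨1, by omega⟩))
      rw [← h]
      simp
  · rintro ⟨u, v, huv, h⟩
    obtain ⟨e⟩ : Nonempty (V ≃ Fin r) := ⟨Fintype.equivFinOfCardEq hV⟩
    obtain ⟨τ, h0, h1⟩ := exists_perm_apply_eq
      (a := (⟨0, by omega⟩ : Fin r)) (b := ⟨1, by omega⟩) (by simp) (e.injective.ne huv)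
    refine ⟨⟨e.trans τ, fun {x y} => ?_⟩⟩
    rw [h, almostComplete_adj, (e.trans τ).injective.ne_iff]
    refine and_congr_right fun _ => not_congr ?_
    rw [← h0, ← h1]
    exact (Sym2.map.injective (e.trans τ).injective).eq_iff (a := s(x, y)) (b := s(u, v))

theorem two_mul_ncard_add_le {n r : ℕ} (hr : 2 ≤ r) (G : SimpleGraph (Fin n))
    [DecidableRel G.Adj] :
    2 * Set.ncard {S : Finset (Fin n) |
        Nonempty (G.induce (S : Set (Fin n)) ≃g almostComplete r hr)} +
      r * (G.cliqueFinset r).card ≤ n * (G.cliqueFinset (r - 1)).card := by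
  classical
  set N : Finset (Finset (Fin n)) := Finset.univ.filter fun S =>
    Nonempty (G.induce (S : Set (Fin n)) ≃g almostComplete r hr) with hN
  have hNc : Set.ncard {S : Finset (Fin n) |
        Nonempty (G.induce (S : Set (Fin n)) ≃g almostComplete r hr)} = N.card := by
    rw [← Set.ncard_coe_finset]; congr 1; ext S; simp [hN]
  rw [hNc]
  -- The vertices whose removal leaves an `(r-1)`-clique: both ends of the missing edge in a
  -- `K_r^-`, all of `S` in a `K_r`.
  let f : Finset (Fin n) → Finset (Fin n) := fun S =>
    S.filter fun a => S.erase a ∈ G.cliqueFinset (r - 1)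
  have hcardN : ∀ S ∈ N, S.card = r := by
    intro S hS
    obtain ⟨φ⟩ := (Finset.mem_filter.1 hS).2
    simpa using Fintype.card_congr φ.toEquiv
  have h2 : ∀ S ∈ N, 2 ≤ (f S).card ∧ ¬ G.IsClique (S : Set (Fin n)) := by
    intro S hS
    have hc := hcardN S hS
    obtain ⟨u, v, huv, h⟩ := (nonempty_iso_almostComplete_iff hr (by simpa using hc) _).1
      (Finset.mem_filter.1 hS).2
    have huv' : (u : Fin n) ≠ v := fun h => huv (Subtype.ext h)
    have hmem : ∀ w : (S : Set (Fin n)), (w = u ∨ w = v) → (w : Fin n) ∈ f S := by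
      intro w hw
      refine Finset.mem_filter.2 ⟨w.2, ?_⟩
      rw [SimpleGraph.mem_cliqueFinset_iff]
      refine ⟨?_, by rw [Finset.card_erase_of_mem w.2, hc]⟩
      intro x hx y hy hxy
      have hx' := Finset.mem_erase.1 (Finset.mem_coe.1 hx)
      have hy' := Finset.mem_erase.1 (Finset.mem_coe.1 hy)
      have := (h ⟨x, hx'.2⟩ ⟨y, hy'.2⟩).2 ⟨fun h => hxy (congrArg Subtype.val h), ?_⟩
      · exact this
      · intro hs
        have hws : w ∈ s((⟨x, hx'.2⟩ : (S : Set (Fin n))), ⟨y, hy'.2⟩) := by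
          rw [hs]; simpa using hw
        rcases Sym2.mem_iff.1 hws with hw' | hw'
        · exact hx'.1 (congrArg Subtype.val hw').symm
        · exact hy'.1 (congrArg Subtype.val hw').symm
    constructor
    · rw [← Finset.card_pair huv']
      refine Finset.card_le_card ?_
      intro a ha
      rcases Finset.mem_insert.1 ha with rfl | ha
      · exact hmem u (Or.inl rfl)
      · rw [Finset.mem_singleton] at ha
        subst ha
        exact hmem v (Or.inr rfl)
    · intro hcl
      have := (h u v).1 (hcl u.2 v.2 huv')
      exact this.2 rfl
  have hK : ∀ S ∈ G.cliqueFinset r, (f S).card = r := by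
    intro S hS
    rw [SimpleGraph.mem_cliqueFinset_iff] at hS
    have : f S = S := by
      refine Finset.filter_true_of_mem fun a ha => ?_
      rw [SimpleGraph.mem_cliqueFinset_iff]
      refine ⟨hS.1.subset ?_, by rw [Finset.card_erase_of_mem ha, hS.2]⟩
      exact_mod_cast Finset.erase_subset _ _
    rw [this, hS.2]
  have hdisj : Disjoint N (G.cliqueFinset r) := by
    rw [Finset.disjoint_left]
    intro S hS hS'
    rw [SimpleGraph.mem_cliqueFinset_iff] at hS'
    exact (h2 S hS).2 hS'.1
  calc 2 * N.card + r * (G.cliqueFinset r).card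
      ≤ ∑ S ∈ N, (f S).card + ∑ S ∈ G.cliqueFinset r, (f S).card := by
        rw [Finset.sum_congr rfl hK, Finset.sum_const, smul_eq_mul, mul_comm r]
        refine Nat.add_le_add_right ?_ _
        rw [mul_comm, ← smul_eq_mul]
        exact Finset.card_nsmul_le_sum _ _ _ fun S hS => (h2 S hS).1
    _ = ∑ S ∈ N ∪ G.cliqueFinset r, (f S).card := (Finset.sum_union hdisj).symm
    _ = ((N ∪ G.cliqueFinset r).sigma f).card := (Finset.card_sigma _ _).symm
    _ ≤ (G.cliqueFinset (r - 1) ×ˢ (Finset.univ : Finset (Fin n))).card := by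
        refine Finset.card_le_card_of_injOn (fun p => (p.1.erase p.2, p.2)) ?_ ?_
        · rintro ⟨S, a⟩ hp
          have := (Finset.mem_sigma.1 (Finset.mem_coe.1 hp)).2
          simpa using (Finset.mem_filter.1 this).2
        · rintro ⟨S, a⟩ hp ⟨S', a'⟩ hp' h
          have h1 : a ∈ S := (Finset.mem_filter.1 (Finset.mem_sigma.1 (Finset.mem_coe.1 hp)).2).1
          have h2 : a' ∈ S' := (Finset.mem_filter.1 (Finset.mem_sigma.1 (Finset.mem_coe.1 hp')).2).1
          simp only [Prod.mk.injEq] at h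
          obtain ⟨h, rfl⟩ := h
          have : S = S' := by
            rw [← Finset.insert_erase h1, h, Finset.insert_erase h2]
          subst this; rfl
    _ = n * (G.cliqueFinset (r - 1)).card := by
        rw [Finset.card_product, Finset.card_univ, Fintype.card_fin, mul_comm]

theorem ncard_le {n r k : ℕ} (hr : 3 ≤ r) (hr2 : 2 ≤ r) (hn : 0 < n) (G : SimpleGraph (Fin n))
    (hG : G.CliqueFree k) (M : ℝ) (hM : ∀ m, 1 ≤ m → m < k → balancedValue r m ≤ M) :
    (Set.ncard {S : Finset (Fin n) |
        Nonempty (G.induce (S : Set (Fin n)) ≃g almostComplete r hr2)} : ℝ) ≤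
      (n : ℝ) ^ r * ((r - 1) / 2 * M) := by
  classical
  have hn0 : (n : ℝ) ≠ 0 := by positivity
  have hcount := two_mul_ncard_add_le hr2 G (r := r)
  set N := Set.ncard {S : Finset (Fin n) |
        Nonempty (G.induce (S : Set (Fin n)) ≃g almostComplete r hr2)}
  -- Chosen so that `n ^ r` times the clique polynomial at weights `1/n` is `n c_{r-1} - r c_r`.
  let w : ℕ → ℝ := fun s => if s = r - 1 then 1 else if s = r then -(r : ℝ) else 0
  have hr1 : r ≠ r - 1 := by omega
  have hcast : ((r - 1 : ℕ) : ℝ) = r - 1 := by push_cast [show 1 ≤ r by omega]; ring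
  have hcl := cliquePoly_le G w hG ((r - 1) * M) ?_ (fun _ => 1 / (n : ℝ)) ?_
  · have hval : cliquePoly G w (fun _ => 1 / (n : ℝ)) =
        (G.cliqueFinset (r - 1)).card * (1 / (n : ℝ)) ^ (r - 1) -
          r * ((G.cliqueFinset r).card * (1 / (n : ℝ)) ^ r) := by
      have e : ∀ s, (G.cliqueFinset s).card * (1 / (n : ℝ)) ^ s =
          ∑ T : Finset (Fin n), if G.IsClique (T : Set (Fin n)) then
            (if T.card = s then (1 / (n : ℝ)) ^ s else 0) else 0 := by
        intro s
        rw [← nsmul_eq_mul, ← Finset.sum_const, SimpleGraph.cliqueFinset, Finset.sum_filter]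
        refine Finset.sum_congr rfl fun T _ => ?_
        by_cases h1 : G.IsClique (T : Set (Fin n)) <;> by_cases h2 : T.card = s <;>
          simp [SimpleGraph.isNClique_iff, h1, h2]
      rw [e, e, Finset.mul_sum, ← Finset.sum_sub_distrib, cliquePoly]
      refine Finset.sum_congr rfl fun T _ => ?_
      by_cases h1 : G.IsClique (T : Set (Fin n))
      · simp only [h1, if_true, Finset.prod_const, w]
        by_cases h2 : T.card = r - 1
        · simp [h2, hr1.symm]
        · by_cases h3 : T.card = r
          · simp [h3, hr1]
          · simp [h2, h3]
      · simp [h1]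
    rw [hval] at hcl
    have h1 : (2 : ℝ) * N + r * (G.cliqueFinset r).card ≤ n * (G.cliqueFinset (r - 1)).card := by
      exact_mod_cast hcount
    have h2 := mul_le_mul_of_nonneg_left hcl (pow_nonneg n.cast_nonneg r : (0 : ℝ) ≤ (n : ℝ) ^ r)
    have h3 : (n : ℝ) ^ r * ((G.cliqueFinset (r - 1)).card * (1 / (n : ℝ)) ^ (r - 1) -
          r * ((G.cliqueFinset r).card * (1 / (n : ℝ)) ^ r)) =
        n * (G.cliqueFinset (r - 1)).card - r * (G.cliqueFinset r).card := by
      obtain ⟨j, rfl⟩ : ∃ j, r = j + 1 := ⟨r - 1, by omega⟩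
      simp only [Nat.add_sub_cancel, one_div, inv_pow]
      field_simp
      ring
    rw [h3] at h2
    linarith
  · intro m hm1 hmk
    have hm0 : (m : ℝ) ≠ 0 := by positivity
    have hM' := hM m hm1 hmk
    have hr' : (0 : ℝ) ≤ r - 1 := by rw [← hcast]; positivity
    refine le_trans (le_of_eq ?_) (mul_le_mul_of_nonneg_left hM' hr')
    have e : ∀ s, (if s ∈ Finset.range (m + 1) then (m.choose s : ℝ) * (1 / (m : ℝ)) ^ s else 0) =
        (m.choose s : ℝ) * (1 / (m : ℝ)) ^ s := by
      intro s
      split_ifs with h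
      · rfl
      · rw [Nat.choose_eq_zero_of_lt (by simpa using h)]; simp
    have h1 : ∑ s ∈ Finset.range (m + 1), (m.choose s : ℝ) * (w s * (1 / (m : ℝ)) ^ s) =
        (m.choose (r - 1) : ℝ) * (1 / (m : ℝ)) ^ (r - 1) -
          r * ((m.choose r : ℝ) * (1 / (m : ℝ)) ^ r) := by
      rw [← e (r - 1), ← e r, ← Finset.sum_ite_eq' (Finset.range (m + 1)) (r - 1)
          fun s => (m.choose s : ℝ) * (1 / (m : ℝ)) ^ s,
        ← Finset.sum_ite_eq' (Finset.range (m + 1)) r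
          fun s => (m.choose s : ℝ) * (1 / (m : ℝ)) ^ s, Finset.mul_sum,
        ← Finset.sum_sub_distrib]
      refine Finset.sum_congr rfl fun s _ => ?_
      simp only [w]
      by_cases h2 : s = r - 1
      · simp [h2, hr1.symm]
      · by_cases h3 : s = r
        · subst h3; simp [hr1]; ring
        · simp [h2, h3]
    rw [h1]
    -- Turns the value on an `m`-clique into `C(m, r-1) / m ^ r` times `m - (m - (r-1)) = r - 1`.
    have h2 : (m.choose r : ℝ) * r = m.choose (r - 1) * (m - (r - 1)) := by
      by_cases h : r ≤ m + 1
      · have h3 := Nat.choose_succ_right_eq m (r - 1)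
        rw [Nat.sub_add_cancel (by omega)] at h3
        have h4 : ((m - (r - 1) : ℕ) : ℝ) = (m : ℝ) - (r - 1) := by
          rw [Nat.cast_sub (by omega), hcast]
        rw [← h4]
        exact_mod_cast h3
      · rw [Nat.choose_eq_zero_of_lt (by omega : m < r),
          Nat.choose_eq_zero_of_lt (by omega : m < r - 1)]
        simp
    rw [balancedValue]
    obtain ⟨j, rfl⟩ : ∃ j, r = j + 1 := ⟨r - 1, by omega⟩
    simp only [Nat.add_sub_cancel, one_div, inv_pow] at h2 ⊢
    field_simp
    push_cast at h2 ⊢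
    linear_combination -(m : ℝ) ^ j * h2
  · refine ⟨fun _ => by positivity, ?_⟩
    simp [hn0]

/-! ### Density of the balanced graphon -/

/-- The colourings of the vertices of `K_r^-` that make it a complete partite graph. -/
noncomputable def almostCompleteColorings (r l : ℕ) (hr : 2 ≤ r) : Finset (Fin r → Fin l) :=
  open Classical in Finset.univ.filter fun c =>
    Nonempty ((⊤ : SimpleGraph (Fin l)).comap c ≃g almostComplete r hr)

/-- Each diagonal `p i = p j` is null by Fubini: once coordinate `i` is fixed, coordinate `j` is
confined to one point. -/
theorem volume_not_injective {r : ℕ} :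
    (volume : Measure (Fin r → I)) {p | ¬ Function.Injective p} = 0 := by
  have hsub : {p : Fin r → I | ¬ Function.Injective p} ⊆
      ⋃ i : Fin r, ⋃ j : Fin r, ⋃ _ : i ≠ j, {p | p i = p j} := by
    intro p hp
    simp only [Set.mem_ofPred_eq, Function.Injective, not_forall] at hp
    obtain ⟨i, j, h, hij⟩ := hp
    simp only [Set.mem_iUnion]
    exact ⟨i, j, hij, h⟩
  refine measure_mono_null hsub ?_
  simp only [measure_iUnion_null_iff]
  intro i j hij
  obtain ⟨n, rfl⟩ : ∃ n, r = n + 1 := ⟨r - 1, by have := i.pos; omega⟩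
  obtain ⟨j', rfl⟩ := Fin.exists_succAbove_eq hij.symm
  have hmp := volume_preserving_piFinSuccAbove (fun _ : Fin (n + 1) => I) i
  have hset : {p : Fin (n + 1) → I | p i = p (i.succAbove j')} =
      (MeasurableEquiv.piFinSuccAbove (fun _ : Fin (n + 1) => I) i) ⁻¹'
        {q : I × (Fin n → I) | q.1 = q.2 j'} := by
    ext p
    rfl
  have hmeas : MeasurableSet {q : I × (Fin n → I) | q.1 = q.2 j'} :=
    measurableSet_eq_fun measurable_fst ((measurable_pi_apply j').comp measurable_snd)
  rw [hset, hmp.measure_preimage hmeas.nullMeasurableSet, Measure.volume_eq_prod,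
    Measure.measure_prod_null_of_ae_null hmeas]
  refine Eventually.of_forall fun x => ?_
  have : Prod.mk x ⁻¹' {q : I × (Fin n → I) | q.1 = q.2 j'} =
      (Function.eval j' : (Fin n → I) → I) ⁻¹' {x} := by
    ext q
    exact eq_comm
  show volume _ = 0
  rw [this]
  exact (measurePreserving_eval (fun _ : Fin n => (volume : Measure I)) j').measure_preimage
    (measurableSet_singleton x).nullMeasurableSet |>.trans (measure_singleton x)


/-- The truncated subtraction puts `u = 0` into part `0`; this is why the first part is a closed
interval and the others are half-open. -/
theorem intervalIndex_uniform {l : ℕ} (hl : 0 < l) (u : I) :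
    intervalIndex (fun _ : Fin l => 1 / (l : ℝ)) u = ⌈(u : ℝ) * l⌉₊ - 1 := by
  have hl0 : (0 : ℝ) < l := by exact_mod_cast hl
  have hle : ⌈(u : ℝ) * l⌉₊ ≤ l := Nat.ceil_le.2 (by nlinarith [u.2.2])
  have : (Finset.univ.filter fun j : Fin l => ∑ i ∈ Finset.Iic j, 1 / (l : ℝ) < (u : ℝ)) =
      Finset.univ.filter fun j : Fin l => (j : ℕ) < ⌈(u : ℝ) * l⌉₊ - 1 := by
    refine Finset.filter_congr fun j _ => ?_
    rw [Finset.sum_const, Fin.card_Iic, nsmul_eq_mul, mul_one_div, div_lt_iff₀ hl0, ← Nat.lt_ceil]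
    omega
  unfold intervalIndex
  rw [this, Fin.card_filter_val_lt]
  omega

theorem intervalIndex_uniform_lt {l : ℕ} (hl : 0 < l) (u : I) :
    intervalIndex (fun _ : Fin l => 1 / (l : ℝ)) u < l := by
  have hle : ⌈(u : ℝ) * l⌉₊ ≤ l :=
    Nat.ceil_le.2 (by nlinarith [u.2.2, (l.cast_nonneg : (0 : ℝ) ≤ l)])
  rw [intervalIndex_uniform hl]
  omega

theorem volume_intervalIndex {l : ℕ} (hl : 0 < l) (c : Fin l) :
    (volume : Measure I) {u | intervalIndex (fun _ : Fin l => 1 / (l : ℝ)) u = c} =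
      ENNReal.ofReal (1 / l) := by
  have hl0 : (0 : ℝ) < l := by exact_mod_cast hl
  have hc : ((c : ℕ) : ℝ) + 1 ≤ l := by exact_mod_cast c.2
  have hc0 : (0 : ℝ) ≤ (c : ℕ) := Nat.cast_nonneg _
  let b : I := ⟨((c : ℕ) + 1) / l, by positivity, by rw [div_le_one hl0]; exact hc⟩
  let a : I := ⟨(c : ℕ) / l, by positivity, by rw [div_le_one hl0]; linarith⟩
  by_cases h : (c : ℕ) = 0
  · have : {u | intervalIndex (fun _ : Fin l => 1 / (l : ℝ)) u = c} = Set.Iic b := by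
      ext u
      change _ = _ ↔ (u : ℝ) ≤ ((c : ℕ) + 1) / l
      rw [intervalIndex_uniform hl, h, le_div_iff₀ hl0, Nat.sub_eq_zero_iff_le, Nat.ceil_le]
      simp
    rw [this, unitInterval.volume_Iic]
    simp [b, h]
  · have : {u | intervalIndex (fun _ : Fin l => 1 / (l : ℝ)) u = c} = Set.Ioc a b := by
      ext u
      change _ = _ ↔ ((c : ℕ) : ℝ) / l < (u : ℝ) ∧ (u : ℝ) ≤ ((c : ℕ) + 1) / l
      rw [intervalIndex_uniform hl, le_div_iff₀ hl0, div_lt_iff₀ hl0, ← Nat.lt_ceil,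
        ← Nat.cast_add_one, ← Nat.ceil_le]
      omega
    rw [this, unitInterval.volume_Ioc]
    congr 1
    simp only [a, b]
    ring

theorem toGraph_completePartiteGraphon {l : ℕ} (hl : 0 < l) :
    (completePartiteGraphon (fun _ : Fin l => 1 / (l : ℝ))).toGraph =
      (⊤ : SimpleGraph (Fin l)).comap fun u => ⟨_, intervalIndex_uniform_lt hl u⟩ := by
  ext u v
  simp only [Graphon.toGraph, completePartiteGraphon, SimpleGraph.comap_adj, SimpleGraph.top_adj,
    ne_eq, Fin.mk.injEq]
  constructor
  · rintro ⟨-, h⟩ h'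
    rw [if_pos h'] at h
    exact absurd h (by decide)
  · intro h
    refine ⟨?_, if_neg h⟩
    rintro rfl
    exact h rfl

theorem cliqueFree_comap_top {α : Type*} {l k : ℕ} (hlk : l < k) (f : α → Fin l) :
    ((⊤ : SimpleGraph (Fin l)).comap f).CliqueFree k :=
  SimpleGraph.Colorable.cliqueFree (n := l) ⟨SimpleGraph.Coloring.mk f fun h => h⟩ hlk

/-- Almost surely only the parts of the sampled points matter, and each of the `l ^ r` patterns of
parts has probability `1 / l ^ r`. -/
theorem density_completePartiteGraphon {r l : ℕ} (hr : 2 ≤ r) (hl : 0 < l) :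
    (completePartiteGraphon (fun _ : Fin l => 1 / (l : ℝ))).density (almostComplete r hr) =
      (almostCompleteColorings r l hr).card / (l : ℝ) ^ r := by
  classical
  have hl0 : (0 : ℝ) < l := by exact_mod_cast hl
  let B : (Fin r → Fin l) → Set (Fin r → I) := fun c =>
    Set.univ.pi fun i => {u | intervalIndex (fun _ : Fin l => 1 / (l : ℝ)) u = c i}
  have hB : ∀ c, MeasurableSet (B c) := fun c =>
    MeasurableSet.univ_pi fun i =>
      measurable_intervalIndex _ (measurableSet_singleton ((c i : Fin l) : ℕ))
  have hvol : ∀ c, (volume : Measure (Fin r → I)).real (B c) = (1 / (l : ℝ)) ^ r := by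
    intro c
    rw [measureReal_def, volume_pi_pi]
    simp only [volume_intervalIndex hl]
    rw [Finset.prod_const, ENNReal.toReal_pow, ENNReal.toReal_ofReal (by positivity)]
    simp
  have hset : {p : Fin r → I | Function.Injective p ∧
      Nonempty ((completePartiteGraphon (fun _ : Fin l => 1 / (l : ℝ))).toGraph.comap p ≃g
        almostComplete r hr)} =ᵐ[volume] ⋃ c ∈ almostCompleteColorings r l hr, B c := by
    have hinj : ∀ᵐ p : Fin r → I, Function.Injective p := ae_iff.2 volume_not_injective
    refine eventuallyEq_set.2 ?_
    filter_upwards [hinj] with p hp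
    rw [toGraph_completePartiteGraphon hl]
    simp only [hp, true_and, Set.mem_iUnion, B, Set.mem_univ_pi, Set.mem_ofPred_eq, exists_prop,
      SimpleGraph.comap_comap]
    constructor
    · intro h
      exact ⟨_, Finset.mem_filter.2 ⟨Finset.mem_univ _, h⟩, fun i => rfl⟩
    · rintro ⟨c, hc, h⟩
      have : c = (fun u => ⟨_, intervalIndex_uniform_lt hl u⟩ : I → Fin l) ∘ p := by
        funext i
        exact Fin.ext (h i).symm
      rw [← this]
      exact (Finset.mem_filter.1 hc).2
  rw [Graphon.density, measureReal_congr hset, measureReal_biUnion_finset ?_ fun c _ => hB c]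
  · simp only [hvol]
    rw [Finset.sum_const, nsmul_eq_mul, one_div, inv_pow, div_eq_mul_inv]
  · intro c _ d _ hcd
    refine Set.disjoint_left.2 fun p hp hp' => hcd ?_
    funext i
    exact Fin.ext ((hp i trivial).symm.trans (hp' i trivial))

/-- Double count of pairs (good colouring, vertex `j` off which it is injective). Only this
direction is needed, to place the upper bound for finite graphs below the graphon density. -/
theorem mul_descFactorial_le_card_almostCompleteColorings {r l : ℕ} (hr : 2 ≤ r) :
    r * ((r - 1) * l.descFactorial (r - 1)) ≤ 2 * (almostCompleteColorings r l hr).card := by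
  classical
  obtain ⟨n, rfl⟩ : ∃ n, r = n + 1 := ⟨r - 1, by omega⟩
  rw [Nat.add_sub_cancel]
  set C := almostCompleteColorings (n + 1) l hr with hC
  let Dj : Fin (n + 1) → (Fin (n + 1) → Fin l) → Prop := fun j c =>
    Function.Injective (c ∘ j.succAbove)
  have h1 : ∀ j, n * l.descFactorial n ≤ (C.filter (Dj j)).card := by
    intro j
    have hcard : n * l.descFactorial n = Fintype.card ((Fin n ↪ Fin l) × Fin n) := by
      simp [Fintype.card_embedding_eq, mul_comm]
    rw [hcard, ← Finset.card_univ]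
    refine Finset.card_le_card_of_injOn
      -- Colour the other vertices injectively and let `j` repeat the colour of one of them.
      (fun p => (Fin.insertNth j (p.1 p.2) p.1 : Fin (n + 1) → Fin l)) ?_ ?_
    · rintro ⟨e, i⟩ -
      refine Finset.mem_coe.2 (Finset.mem_filter.2 ⟨Finset.mem_filter.2 ⟨Finset.mem_univ _, ?_⟩, ?_⟩)
      · rw [nonempty_iso_almostComplete_iff hr (Fintype.card_fin _)]
        refine ⟨j, j.succAbove i, (Fin.succAbove_ne j i).symm, fun x y => ?_⟩
        simp only [SimpleGraph.comap_adj, SimpleGraph.top_adj]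
        rcases Fin.eq_self_or_eq_succAbove j x with hx | ⟨a, rfl⟩ <;>
          rcases Fin.eq_self_or_eq_succAbove j y with hy | ⟨b, rfl⟩
        · simp [hx, hy]
        · simp [hx, eq_comm]
        · simp [hy, Fin.succAbove_ne]
        · simp [Fin.succAbove_ne]
      · intro a b hab
        simpa using hab
    · rintro ⟨e, i⟩ - ⟨e', i'⟩ - h
      simp only at h
      have he : e = e' := by
        ext a
        have := congrFun h (j.succAbove a)
        simp only [Fin.insertNth_apply_succAbove] at this
        rw [this]
      subst he
      have := congrFun h j
      simp only [Fin.insertNth_apply_same] at this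
      rw [e.injective this]
  -- Such a `j` must be an end of the missing edge, since the two ends share a colour.
  have h2 : ∀ c ∈ C, (Finset.univ.filter fun j => Dj j c).card ≤ 2 := by
    intro c hc
    obtain ⟨u, v, huv, h⟩ := (nonempty_iso_almostComplete_iff hr (Fintype.card_fin _) _).1
      (Finset.mem_filter.1 hc).2
    refine le_trans (Finset.card_le_card (t := {u, v}) ?_) Finset.card_le_two
    intro j hj
    by_contra hne
    simp only [Finset.mem_insert, Finset.mem_singleton, not_or] at hne
    obtain ⟨a, rfl⟩ := Fin.exists_succAbove_eq (Ne.symm hne.1)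
    obtain ⟨b, rfl⟩ := Fin.exists_succAbove_eq (Ne.symm hne.2)
    have hcc : c (j.succAbove a) = c (j.succAbove b) := by
      by_contra hcc
      exact ((h _ _).1 hcc).2 rfl
    exact huv (congrArg _ ((Finset.mem_filter.1 hj).2 hcc))
  calc (n + 1) * (n * l.descFactorial n) = ∑ _j : Fin (n + 1), n * l.descFactorial n := by simp
    _ ≤ ∑ j, (C.filter (Dj j)).card := Finset.sum_le_sum fun j _ => h1 j
    _ = ∑ c ∈ C, (Finset.univ.filter fun j => Dj j c).card := by
        simp only [Finset.card_filter]
        exact Finset.sum_comm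
    _ ≤ ∑ _c ∈ C, 2 := Finset.sum_le_sum h2
    _ = 2 * C.card := by rw [Finset.sum_const, smul_eq_mul, mul_comm]

/-! ### Lower bound from residue colourings -/

/-- A complete `l`-partite graph on `n` vertices with parts of almost equal sizes. -/
def residueGraph (n l : ℕ) (hl : 0 < l) : SimpleGraph (Fin n) :=
  (⊤ : SimpleGraph (Fin l)).comap fun v => ⟨v % l, Nat.mod_lt _ hl⟩

/-- Inclusion–exclusion among maps `Fin r → Fin n`: `X` has a good colour pattern, `Y` is injective,
and `|X| + |Y| = |X ∪ Y| + |X ∩ Y|` with `|X ∪ Y| ≤ n ^ r`. -/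
theorem card_colorings_mul_le {n r l : ℕ} (hr : 2 ≤ r) (hl : 0 < l) :
    (almostCompleteColorings r l hr).card * (n / l) ^ r + n.descFactorial r ≤
      Set.ncard {S : Finset (Fin n) |
        Nonempty ((residueGraph n l hl).induce (S : Set (Fin n)) ≃g almostComplete r hr)} *
        r.factorial + n ^ r := by
  classical
  set C := almostCompleteColorings r l hr
  set N : Finset (Finset (Fin n)) := Finset.univ.filter fun S =>
    Nonempty ((residueGraph n l hl).induce (S : Set (Fin n)) ≃g almostComplete r hr) with hN
  have hNc : Set.ncard {S : Finset (Fin n) |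
        Nonempty ((residueGraph n l hl).induce (S : Set (Fin n)) ≃g almostComplete r hr)} =
      N.card := by
    rw [← Set.ncard_coe_finset]; congr 1; ext S; simp [hN]
  rw [hNc]
  let col : Fin n → Fin l := fun v => ⟨v % l, Nat.mod_lt _ hl⟩
  let X : Finset (Fin r → Fin n) := Finset.univ.filter fun f => col ∘ f ∈ C
  let Y : Finset (Fin r → Fin n) := Finset.univ.filter fun f => Function.Injective f
  have hX : C.card * (n / l) ^ r ≤ X.card := by
    have hcard : C.card * (n / l) ^ r =
        (C ×ˢ (Finset.univ : Finset (Fin r → Fin (n / l)))).card := by simp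
    rw [hcard]
    -- The vertices `l * a + b` with `a < n / l` give every residue `b` at least `n / l` members.
    have hlt : ∀ (a : Fin (n / l)) (b : Fin l), l * a + b < n := by
      intro a b
      have h1 : l * (a + 1) ≤ l * (n / l) := Nat.mul_le_mul_left _ a.2
      have h2 := Nat.mul_div_le n l
      have h3 := b.2
      rw [Nat.mul_add] at h1
      omega
    have hcol : ∀ (a : Fin (n / l)) (b : Fin l), col ⟨l * a + b, hlt a b⟩ = b := by
      intro a b
      refine Fin.ext ?_
      simp only [col]
      rw [Nat.mul_add_mod, Nat.mod_eq_of_lt b.2]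
    refine Finset.card_le_card_of_injOn (fun p i => ⟨l * p.2 i + p.1 i, hlt _ _⟩) ?_ ?_
    · rintro ⟨c, a⟩ hp
      have hc := (Finset.mem_product.1 (Finset.mem_coe.1 hp)).1
      refine Finset.mem_coe.2 (Finset.mem_filter.2 ⟨Finset.mem_univ _, ?_⟩)
      convert hc using 1
      funext i
      exact hcol _ _
    · rintro ⟨c, a⟩ - ⟨c', a'⟩ - h
      have hc : c = c' := by
        funext i
        rw [← hcol (a i) (c i), ← hcol (a' i) (c' i)]
        exact congrArg col (congrFun h i)
      subst hc
      have ha : a = a' := by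
        funext i
        have h1 := congrArg Fin.val (congrFun h i)
        simp only at h1
        exact Fin.ext (Nat.eq_of_mul_eq_mul_left hl (by omega))
      rw [ha]
  have hY : Y.card = n.descFactorial r := by
    have h := Fintype.card_embedding_eq (α := Fin r) (β := Fin n)
    rw [Fintype.card_fin, Fintype.card_fin] at h
    rw [← h, ← Fintype.card_subtype]
    exact Fintype.card_congr (Equiv.subtypeInjectiveEquivEmbedding _ _)
  -- A copy is the image of at most `r!` injective maps.
  have hXY : (X ∩ Y).card ≤ r.factorial * N.card := by
    refine Finset.card_le_mul_card_image_of_maps_to (f := fun f => Finset.univ.image f) ?_ _ ?_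
    · intro f hf
      obtain ⟨h1, h2⟩ := Finset.mem_inter.1 hf
      obtain ⟨φ⟩ := (Finset.mem_filter.1 (Finset.mem_filter.1 h1).2).2
      have hinj := (Finset.mem_filter.1 h2).2
      refine Finset.mem_filter.2 ⟨Finset.mem_univ _, ⟨?_⟩⟩
      let e : Fin r ≃ ((Finset.univ.image f : Finset (Fin n)) : Set (Fin n)) :=
        (Equiv.ofInjective f hinj).trans (Equiv.setCongr (by simp))
      exact (RelIso.symm ⟨e, Iff.rfl⟩ : (residueGraph n l hl).induce _ ≃g
        (⊤ : SimpleGraph (Fin l)).comap (col ∘ f)).trans φ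
    · intro S hS
      obtain ⟨φ⟩ := (Finset.mem_filter.1 hS).2
      have hSc : S.card = r := by simpa using Fintype.card_congr φ.toEquiv
      set Z := (X ∩ Y).filter fun f => Finset.univ.image f = S with hZ
      have hmem : ∀ f ∈ Z, Function.Injective f ∧ ∀ i, f i ∈ S := by
        intro f hf
        obtain ⟨h1, h2⟩ := Finset.mem_filter.1 hf
        refine ⟨(Finset.mem_filter.1 (Finset.mem_inter.1 h1).2).2, fun i => ?_⟩
        rw [← h2]
        exact Finset.mem_image_of_mem _ (Finset.mem_univ _)
      have h := Fintype.card_le_of_injective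
        (fun f : Z => (⟨fun i => ⟨f.1 i, (hmem f.1 f.2).2 i⟩, fun i j hij =>
          (hmem f.1 f.2).1 (congrArg Subtype.val hij)⟩ : Fin r ↪ S)) ?_
      · simpa [Fintype.card_embedding_eq, hSc, Nat.descFactorial_self] using h
      · intro f g hfg
        refine Subtype.ext (funext fun i => ?_)
        exact congrArg Subtype.val (DFunLike.congr_fun hfg i)
  have hunion : (X ∪ Y).card ≤ n ^ r := by
    refine (Finset.card_le_univ _).trans (by simp)
  have := Finset.card_union_add_card_inter X Y
  rw [mul_comm N.card]
  omega

/-! ### Passage to the limit -/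

theorem tendsto_pow_div_descFactorial (r : ℕ) :
    Tendsto (fun n : ℕ => (n : ℝ) ^ r / n.descFactorial r) atTop (𝓝 1) := by
  have h := (isEquivalent_descFactorial r).symm
  rw [Asymptotics.isEquivalent_iff_tendsto_one] at h
  · exact h
  · filter_upwards [eventually_ge_atTop r] with n hn
    have := Nat.descFactorial_pos.2 hn
    positivity

theorem tendsto_div_pow_div_descFactorial (r : ℕ) {l : ℕ} (hl : 0 < l) :
    Tendsto (fun n : ℕ => ((n / l : ℕ) : ℝ) ^ r / n.descFactorial r) atTop
      (𝓝 (1 / (l : ℝ) ^ r)) := by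
  have hl0 : (0 : ℝ) < l := by exact_mod_cast hl
  have h1 : Tendsto (fun n : ℕ => ((n / l : ℕ) : ℝ) / n) atTop (𝓝 (1 / l)) := by
    have h := (tendsto_nat_floor_mul_div_atTop (R := ℝ) (a := 1 / l) (by positivity)).comp
      tendsto_natCast_atTop_atTop
    refine h.congr fun n => ?_
    simp only [Function.comp_apply]
    rw [one_div_mul_eq_div, Nat.floor_div_eq_div]
  have h2 := (h1.pow r).mul (tendsto_pow_div_descFactorial r)
  rw [mul_one, one_div, inv_pow, ← one_div] at h2
  refine h2.congr' ?_
  filter_upwards [eventually_gt_atTop 0] with n hn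
  have hn0 : (n : ℝ) ≠ 0 := by positivity
  rw [div_pow, div_mul_div_cancel₀ (pow_ne_zero _ hn0)]

theorem inducedDensity_eq {n r : ℕ} (hr : 2 ≤ r) (G : SimpleGraph (Fin n)) :
    inducedDensity (almostComplete r hr) G =
      Set.ncard {S : Finset (Fin n) |
        Nonempty (G.induce (S : Set (Fin n)) ≃g almostComplete r hr)} * r.factorial /
        n.descFactorial r := by
  have h := Nat.descFactorial_eq_factorial_mul_choose n r
  have hf : (r.factorial : ℝ) ≠ 0 := by positivity
  rw [inducedDensity, Fintype.card_fin, Fintype.card_fin, h]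
  push_cast
  rw [mul_comm (r.factorial : ℝ), mul_div_mul_right _ _ hf]

theorem isAttainedBy_uniform {r k l : ℕ} (hr : 3 ≤ r) (hr2 : 2 ≤ r) (hl : 0 < l) (hlk : l < k)
    (hmax : ∀ m, 1 ≤ m → m < k → balancedValue r m ≤ balancedValue r l) :
    IsAttainedBy (⊤ : SimpleGraph (Fin k)) (almostComplete r hr2)
      (completePartiteGraphon (fun _ : Fin l => 1 / (l : ℝ))) := by
  have hl0 : (0 : ℝ) < l := by exact_mod_cast hl
  have hfree : ∀ {α : Type} (G : SimpleGraph α), (⊤ : SimpleGraph (Fin k)).Free G ↔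
      G.CliqueFree k := by
    intro α G
    have := SimpleGraph.cliqueFree_iff_top_free (G := G) (β := Fin k)
    rw [Fintype.card_fin] at this
    exact this.symm
  refine ⟨?_, ?_⟩
  · rw [hfree, toGraph_completePartiteGraphon hl]
    exact cliqueFree_comap_top hlk _
  rw [density_completePartiteGraphon hr2 hl]
  set c := (almostCompleteColorings r l hr2).card with hc
  have hlow : Tendsto (fun n : ℕ => (c : ℝ) * (((n / l : ℕ) : ℝ) ^ r / n.descFactorial r) + 1 -
      (n : ℝ) ^ r / n.descFactorial r) atTop (𝓝 (c / (l : ℝ) ^ r)) := by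
    have h := (((tendsto_div_pow_div_descFactorial r hl).const_mul (c : ℝ)).add_const 1).sub
      (tendsto_pow_div_descFactorial r)
    convert h using 2
    ring
  have hupp : Tendsto (fun n : ℕ => (c : ℝ) / (l : ℝ) ^ r * ((n : ℝ) ^ r / n.descFactorial r))
      atTop (𝓝 (c / (l : ℝ) ^ r)) := by
    have h := (tendsto_pow_div_descFactorial r).const_mul ((c : ℝ) / (l : ℝ) ^ r)
    rwa [mul_one] at h
  refine tendsto_of_tendsto_of_tendsto_of_le_of_le' hlow hupp ?_ ?_
  · filter_upwards [eventually_ge_atTop r] with n hn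
    have hd : (0 : ℝ) < n.descFactorial r := by exact_mod_cast Nat.descFactorial_pos.2 hn
    have hG : (⊤ : SimpleGraph (Fin k)).Free (residueGraph n l hl) :=
      (hfree _).2 (cliqueFree_comap_top hlk _)
    refine le_trans ?_ (le_ciSup (f := fun G : {G : SimpleGraph (Fin n) //
      (⊤ : SimpleGraph (Fin k)).Free G} => inducedDensity (almostComplete r hr2) G.1)
      (Set.finite_range _).bddAbove ⟨_, hG⟩)
    simp only
    rw [inducedDensity_eq]
    have h := card_colorings_mul_le (n := n) (r := r) hr2 hl
    rw [← hc] at h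
    have h' : (c : ℝ) * ((n / l : ℕ) : ℝ) ^ r + n.descFactorial r ≤ Set.ncard {S : Finset (Fin n) |
        Nonempty ((residueGraph n l hl).induce (S : Set (Fin n)) ≃g
          almostComplete r hr2)} * r.factorial + (n : ℝ) ^ r := by exact_mod_cast h
    rw [mul_div_assoc', ← div_self hd.ne', ← add_div, ← sub_div]
    gcongr
    linarith
  · filter_upwards [eventually_ge_atTop r] with n hn
    have hd : (0 : ℝ) < n.descFactorial r := by exact_mod_cast Nat.descFactorial_pos.2 hn
    have hG : (⊤ : SimpleGraph (Fin k)).Free (residueGraph n l hl) :=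
      (hfree _).2 (cliqueFree_comap_top hlk _)
    have : Nonempty {G : SimpleGraph (Fin n) // (⊤ : SimpleGraph (Fin k)).Free G} := ⟨⟨_, hG⟩⟩
    refine ciSup_le fun G => ?_
    have h := ncard_le hr hr2 (by omega) G.1 ((hfree _).1 G.2) _ hmax
    have hC := mul_descFactorial_le_card_almostCompleteColorings (l := l) hr2
    rw [← hc, Nat.descFactorial_eq_factorial_mul_choose] at hC
    -- Matches the constant of `ncard_le` with the graphon density, so both bounds have the same
    -- limit.
    have hC' : ((r : ℝ) - 1) / 2 * balancedValue r l * r.factorial ≤ c / (l : ℝ) ^ r := by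
      obtain ⟨j, rfl⟩ : ∃ j, r = j + 1 := ⟨r - 1, by omega⟩
      rw [Nat.add_sub_cancel] at hC
      have hC2 : ((j : ℝ) + 1) * (j * (j.factorial * l.choose j)) ≤ 2 * c := by exact_mod_cast hC
      rw [balancedValue, le_div_iff₀ (by positivity), Nat.factorial_succ, Nat.add_sub_cancel]
      push_cast
      field_simp
      linarith
    have h' := mul_le_mul_of_nonneg_right h (r.factorial.cast_nonneg : (0 : ℝ) ≤ r.factorial)
    have h'' := mul_le_mul_of_nonneg_right hC' (pow_nonneg n.cast_nonneg r : (0 : ℝ) ≤ (n : ℝ) ^ r)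
    rw [inducedDensity_eq, mul_div_assoc']
    exact div_le_div_of_nonneg_right (by linarith) hd.le

end Inducibility

theorem theorem1p5 (r k t : ℕ) (hr : 3 ≤ r) (hk : 3 ≤ k)
    (ht : t = ⌈((r : ℚ) - 2) * (3 * (r : ℚ) + 1) / 6⌉₊) :
    (k ≤ t + 1 →
      Inducibility.IsAttainedBy (⊤ : SimpleGraph (Fin k))
        (Inducibility.almostComplete r (by omega))
        (Inducibility.completePartiteGraphon (fun _ : Fin (k - 1) => 1 / ((k : ℝ) - 1)))) ∧
    (t + 1 < k →
      Inducibility.IsAttainedBy (⊤ : SimpleGraph (Fin k))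
        (Inducibility.almostComplete r (by omega))
        (Inducibility.completePartiteGraphon (fun _ : Fin t => 1 / (t : ℝ)))) := by
  have hr3 : (3 : ℚ) ≤ r := by exact_mod_cast hr
  have hpos : 0 < ((r : ℚ) - 2) * (3 * (r : ℚ) + 1) / 6 := by
    have : (0 : ℚ) < r - 2 := by linarith
    positivity
  have ht0 : 0 < t := by rw [ht]; exact Nat.ceil_pos.2 hpos
  -- The ceiling supplies two inequalities: this one gives the decrease from `t` on, the strict one
  -- below gives the increase up to `t`.
  have hlo : ((r : ℝ) - 2) * (3 * (r : ℝ) + 1) / 6 ≤ t := by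
    have h : ((r : ℚ) - 2) * (3 * (r : ℚ) + 1) / 6 ≤ t := by rw [ht]; exact Nat.le_ceil _
    exact_mod_cast h
  have hhi : (t : ℝ) < ((r : ℝ) - 2) * (3 * (r : ℝ) + 1) / 6 + 1 := by
    have h : (t : ℚ) < ((r : ℚ) - 2) * (3 * (r : ℚ) + 1) / 6 + 1 := by
      rw [ht]; exact Nat.ceil_lt_add_one hpos.le
    exact_mod_cast h
  constructor
  · intro hkt
    have hcast : (k : ℝ) - 1 = ((k - 1 : ℕ) : ℝ) := by
      rw [Nat.cast_sub (by omega), Nat.cast_one]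
    rw [hcast]
    exact Inducibility.isAttainedBy_uniform hr _ (by omega) (by omega) fun m _ hmk =>
      Inducibility.balancedValue_mono hr hhi (by omega) (by omega)
  · intro hkt
    refine Inducibility.isAttainedBy_uniform hr _ ht0 (by omega) fun m _ _ => ?_
    rcases le_total m t with h | h
    · exact Inducibility.balancedValue_mono hr hhi h le_rfl
    · exact Inducibility.balancedValue_anti hr hlo h
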